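/- \textbf{Theorem (RVU Bound for Swap Regret).} \label{theorem:rvu-swap} Let $\mathcal{A}$ be a finite nonempty set of $m$ actions, let $\Delta(\mathcal{A})$ be the probability simplex over $\mathcal{A}$, and let $\mathcal{R}(x) = -\sum_{r \in \mathcal{A}} \log x[r]$ be the log-barrier on its relative interior $\mathrm{relint}\,\Delta(\mathcal{A}) = \{x \in \Delta(\mathcal{A}) : x[r] > 0 \text{ for all } r\}$ (with $\mathcal{R} = +\infty$ on the relative boundary). Let $u^{(0)}, u^{(1)}, u^{(2)}, \dots \in \mathbb{R}^{\mathcal{A}}$ be any sequence of utility vectors and let $\eta > 0$. Consider the Blum--Mansour algorithm in which the internal regret minimizer $\mathfrak{R}_a$ of each action $a \in \mathcal{A}$ is optimistic follow the regularized leader with regularizer $\mathcal{R}$, learning rate $\eta$, and the last observed utility as prediction. That is, for every $t \ge 0$: \begin{itemize} \item the strategy of $\mathfrak{R}_a$ is $x_a^{(0)} = \arg\min_{x} \mathcal{R}(x)$ if $t = 0$, and for $t \ge 1$ it is \[ x_a^{(t)} = \arg\max_{x} \Big\{ \eta \Big\langle x,\; u_a^{(t-1)} + \sum_{\tau=1}^{t-1}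 u_a^{(\tau)} \Big\rangle - \mathcal{R}(x) \Big\}, \] both over $x \in \mathrm{relint}\,\Delta(\mathcal{A})$; \item $x^{(t)} \in \Delta(\mathcal{A})$ is a stationary distribution of the row-stochastic matrix $Q^{(t)}$ with rows $x_a^{(t)}$, i.e.\ $(Q^{(t)})^\top x^{(t)} = x^{(t)}$; \item $\mathfrak{R}_a$ receives the utility $u_a^{(t)} = x^{(t)}[a]\, u^{(t)}$. \end{itemize} For $T \in \mathbb{N}$ let \[ \mathrm{SwapReg}^T = \max_{\phi} \sum_{t=1}^T \langle \phi(x^{(t)}), u^{(t)} \rangle - \sum_{t=1}^T \langle x^{(t)}, u^{(t)} \rangle, \] the maximum being over all linear maps $\phi$ that map $\Delta(\mathcal{A})$ to itself. If $\eta \le \frac{1}{128\sqrt{m}}$, $T \ge 2$, and $\|u^{(t)}\|_\infty \le 1$ for all $0 \le t \le T$, then \[ \mathrm{SwapReg}^T \le \frac{2 m^2 \log T}{\eta} + 4 \eta \sum_{t=1}^T \| u^{(t)} - u^{(t-1)} \|_\infty^2 - \frac{1}{2048\, m\, \eta} \sum_{t=1}^T \| x^{(t)} - x^{(t-1)} \|_1^2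 . \] -/

import Mathlib

namespace BMOFTRL

open Finset Matrix

variable {A : Type*} [Fintype A]

/-- The relative interior of the probability simplex `Δ(A)`: all coordinates are positive. -/
def relintSimplex (A : Type*) [Fintype A] : Set (A → ℝ) :=
  {x | x ∈ stdSimplex ℝ A ∧ ∀ r, 0 < x r}

/-- The log-barrier `R(x) = - ∑ r, log x[r]`. It is used on `relintSimplex A` only, which is its
effective domain in the simplex (it is `+∞` at the relative boundary). -/
noncomputable def logBarrier (x : A → ℝ) : ℝ := -∑ r, Real.log (x r)

/-- `x` is the sequence of strategies of optimistic follow the regularized leader with learning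
rate `η`, regularizer `R` with effective domain `D`, and prediction `u (t - 1)` at time `t`, on the
utilities `u`: at time `0` it minimizes `R` over `D`, and at each time `t ≥ 1` it maximizes
`η ⟪y, u (t - 1) + ∑ τ = 1, …, t - 1, u τ⟫ - R y` over `y ∈ D`. -/
def IsOFTRL (D : Set (A → ℝ)) (R : (A → ℝ) → ℝ) (η : ℝ) (u x : ℕ → A → ℝ) : Prop :=
  (x 0 ∈ D ∧ IsMinOn R D (x 0)) ∧
    ∀ t, 1 ≤ t → x t ∈ D ∧
      IsMaxOn (fun y => η * (y ⬝ᵥ (u (t - 1) + ∑ τ ∈ Icc 1 (t - 1), u τ)) - R y) D (x t)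

/-- `(Q, x)` is a run, on the utilities `u`, of the Blum–Mansour algorithm whose internal regret
minimizers (one for each action `a`) are OFTRL with log-barrier regularization and learning rate
`η`. The row `Q t a` is the strategy of the minimizer of `a` at time `t`, the minimizer of `a` is
fed the utility `x t a • u t`, and the strategy `x t` is a stationary distribution of `Q t`. -/
def IsRun (η : ℝ) (u : ℕ → A → ℝ) (Q : ℕ → Matrix A A ℝ) (x : ℕ → A → ℝ) : Prop :=
  (∀ a, IsOFTRL (relintSimplex A) logBarrier η (fun t => x t a • u t) (fun t => Q t a)) ∧
    ∀ t, x t ∈ stdSimplex ℝ A ∧ (Q t)ᵀ *ᵥ x t = x t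

/-- The differences `∑ t, ⟪φ (x t), u t⟫ - ∑ t, ⟪x t, u t⟫` over times `1, …, T`, for all linear
maps `φ` that map the simplex to itself. -/
def swapGains (u x : ℕ → A → ℝ) (T : ℕ) : Set ℝ :=
  {r | ∃ φ : (A → ℝ) →ₗ[ℝ] (A → ℝ), Set.MapsTo φ (stdSimplex ℝ A) (stdSimplex ℝ A) ∧
    r = ∑ t ∈ Icc 1 T, φ (x t) ⬝ᵥ u t - ∑ t ∈ Icc 1 T, x t ⬝ᵥ u t}

/-- The swap regret of the strategies `x` under the utilities `u` up to time `T`. -/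
noncomputable def swapRegret (u x : ℕ → A → ℝ) (T : ℕ) : ℝ := sSup (swapGains u x T)

/-- The supremum that defines the swap regret is a genuine one. -/
theorem isLUB_swapRegret (u x : ℕ → A → ℝ) (T : ℕ) (hx : ∀ t, x t ∈ stdSimplex ℝ A) :
    IsLUB (swapGains u x T) (swapRegret u x T) := by
  refine isLUB_csSup ⟨_, LinearMap.id, fun _ h => h, rfl⟩
    ⟨∑ t ∈ Icc 1 T, ∑ a, |u t a| - ∑ t ∈ Icc 1 T, x t ⬝ᵥ u t, ?_⟩
  rintro _ ⟨φ, hφ, rfl⟩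
  refine sub_le_sub_right (sum_le_sum fun t _ => sum_le_sum fun a _ => ?_) _
  have h := hφ (hx t)
  have h1 : φ (x t) a ≤ 1 := by
    rw [← h.2]
    exact single_le_sum (f := φ (x t)) (fun i _ => h.1 i) (mem_univ a)
  calc φ (x t) a * u t a ≤ φ (x t) a * |u t a| :=
        mul_le_mul_of_nonneg_left (le_abs_self _) (h.1 a)
    _ ≤ 1 * |u t a| := mul_le_mul_of_nonneg_right h1 (abs_nonneg _)
    _ = |u t a| := one_mul _

end BMOFTRL

namespace BMOFTRL

open Finset Matrix

variable {A : Type*} [Fintype A]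

/-! ### Stationary distributions of positive stochastic matrices -/

/-! A linear `φ` is determined by its values at the vertices, and `x t` is stationary for `Q t`, so
the swap gain of `φ` is the sum over `a` of the regret of the internal minimizer `a` against `φ
(Pi.single a 1)` (`IsRun.swapGain_eq`). Each internal minimizer has an RVU bound
(`IsOFTRL.exists_rvu`) whose negative terms are Bregman divergences of the log-barrier. Its positive
terms add up to the variation of `u` plus a multiple of `η ^ 2` times the squared `ℓ¹` movement of
`x` (`sum_norm_smul_sub_smul_sq_le`). The crux is that the negative terms pay for that movement.
Log-barrier divergences control the logarithms of coordinate ratios of the rows, and a stationary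
distribution is stable under multiplicative changes of rows; together these give
`IsStationary.sq_sum_abs_sub_le_logBregman`. Small `η` leaves a negative multiple of the movement.
Comparators on the boundary are first mixed with the uniform distribution with weight `1 / T`. -/

/-- `p` is a stationary distribution of `Q`. -/
def IsStationary (Q : Matrix A A ℝ) (p : A → ℝ) : Prop :=
  p ∈ stdSimplex ℝ A ∧ Qᵀ *ᵥ p = p

/-- All rows of `Q` lie in the relative interior of the simplex. -/
def IsPosStochastic (Q : Matrix A A ℝ) : Prop := ∀ a, Q a ∈ relintSimplex A

theorem nonempty_of_mem_stdSimplex {p : A → ℝ} (hp : p ∈ stdSimplex ℝ A) : Nonempty A := by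
  by_contra h
  rw [not_nonempty_iff] at h
  simpa using hp.2

theorem IsStationary.sum_eq {Q : Matrix A A ℝ} {p : A → ℝ} (h : IsStationary Q p) (j : A) :
    ∑ i, p i * Q i j = p j := by
  have := congrFun h.2 j
  rw [mulVec, dotProduct] at this
  rw [← this]
  exact sum_congr rfl fun i _ => by rw [transpose_apply, mul_comm]

theorem IsStationary.pos {Q : Matrix A A ℝ} {p : A → ℝ} (h : IsStationary Q p)
    (hQ : IsPosStochastic Q) (j : A) : 0 < p j := by
  obtain ⟨i, hi⟩ : ∃ i, 0 < p i := by
    by_contra! hn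
    have := sum_nonpos (s := univ) fun i _ => hn i
    rw [h.1.2] at this
    linarith
  rw [← h.sum_eq j]
  exact sum_pos' (fun i _ => mul_nonneg (h.1.1 i) ((hQ i).2 j).le)
    ⟨i, mem_univ i, mul_pos hi ((hQ i).2 j)⟩

/-- Since `Q` fixes the all-ones vector, it has a left eigenvector `v` for eigenvalue 1. The
triangle inequality gives `|v| ≤ |v| Q` coordinatewise, and both sides have the same total, so `|v|`
is itself invariant. -/
theorem exists_isStationary [Nonempty A] {Q : Matrix A A ℝ} (hQ : ∀ a, Q a ∈ stdSimplex ℝ A) :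
    ∃ p, IsStationary Q p := by
  classical
  have hdet : (1 - Q).det = 0 := by
    refine exists_mulVec_eq_zero_iff.1 ⟨1, one_ne_zero, ?_⟩
    ext a
    rw [sub_mulVec, one_mulVec]
    simp [mulVec, dotProduct, (hQ a).2]
  obtain ⟨v, hv0, hv⟩ := exists_vecMul_eq_zero_iff.2 hdet
  have hv' : ∀ j, ∑ i, v i * Q i j = v j := fun j => by
    have := congrFun hv j
    rw [vecMul_sub, vecMul_one] at this
    simp only [Pi.sub_apply, Pi.zero_apply, vecMul, dotProduct] at this
    linarith
  have hle : ∀ j ∈ univ, |v j| ≤ ∑ i, |v i| * Q i j := fun j _ => by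
    rw [← hv' j]
    refine (abs_sum_le_sum_abs _ _).trans (le_of_eq (sum_congr rfl fun i _ => ?_))
    rw [abs_mul, abs_of_nonneg ((hQ i).1 j)]
  have hsum : ∑ j, |v j| = ∑ j, ∑ i, |v i| * Q i j := by
    rw [sum_comm]
    exact sum_congr rfl fun i _ => by rw [← mul_sum, (hQ i).2, mul_one]
  have heq := (sum_eq_sum_iff_of_le hle).1 hsum
  have hpos : 0 < ∑ j, |v j| := by
    obtain ⟨i, hi⟩ := Function.ne_iff.1 hv0
    exact sum_pos' (fun i _ => abs_nonneg _) ⟨i, mem_univ i, abs_pos.2 hi⟩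
  refine ⟨fun j => |v j| / ∑ i, |v i|, ⟨fun j => by positivity, ?_⟩, ?_⟩
  · rw [← sum_div, div_self hpos.ne']
  · ext j
    simp only [mulVec, dotProduct, transpose_apply]
    rw [heq j (mem_univ j), sum_div]
    exact sum_congr rfl fun i _ => by ring

/-- If two chains differ in row `a` only, by a factor of at most `c`, then so do their stationary
distributions, normalized at `a`. -/
theorem IsStationary.mul_le_of_row {Q Q' : Matrix A A ℝ} {p p' : A → ℝ} (h : IsStationary Q p)
    (h' : IsStationary Q' p') (hQ : IsPosStochastic Q) {a : A} {c : ℝ}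
    (hrow : ∀ i, i ≠ a → Q' i = Q i) (ha : ∀ j, Q' a j ≤ c * Q a j) (i : A) :
    p' i * p a ≤ c * (p i * p' a) := by
  classical
  have hp := h.pos hQ
  -- Maximum principle: in the balance equation at the maximizer `j` of `p' / p`, the rows other
  -- than `a` contribute at most `M` times their share, so row `a` must supply the rest.
  obtain ⟨j, -, hj⟩ := exists_max_image univ (fun i => p' i / p i) ⟨a, mem_univ a⟩
  have hmax : ∀ i, p' i ≤ p' j / p j * p i := fun i =>
    (div_le_iff₀ (hp i)).1 (hj i (mem_univ i))
  set M := p' j / p j with hM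
  have h1 : p' j = M * p j := by rw [hM, div_mul_cancel₀ _ (hp j).ne']
  have key : M * p a ≤ c * p' a := by
    have e' := h'.sum_eq j
    have e := h.sum_eq j
    rw [← add_sum_erase _ _ (mem_univ a)] at e e'
    have hle : ∑ i ∈ univ.erase a, p' i * Q' i j ≤ M * ∑ i ∈ univ.erase a, p i * Q i j := by
      rw [mul_sum]
      refine sum_le_sum fun i hi => ?_
      rw [hrow i (ne_of_mem_erase hi), ← mul_assoc]
      exact mul_le_mul_of_nonneg_right (hmax i) ((hQ i).2 j).le
    have h2 : p' a * Q' a j ≤ p' a * (c * Q a j) :=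
      mul_le_mul_of_nonneg_left (ha j) (h'.1.1 a)
    have h3 : (M * p a) * Q a j ≤ (c * p' a) * Q a j := by
      have : M * p j = M * (p a * Q a j) + M * ∑ i ∈ univ.erase a, p i * Q i j := by
        rw [← mul_add, e]
      linarith
    exact le_of_mul_le_mul_right h3 ((hQ a).2 j)
  calc p' i * p a ≤ M * p i * p a := mul_le_mul_of_nonneg_right (hmax i) (hp a).le
    _ = M * p a * p i := by ring
    _ ≤ c * p' a * p i := mul_le_mul_of_nonneg_right key (hp i).le
    _ = c * (p i * p' a) := by ring

/-- Summing the normalized comparison with the roles exchanged gives `p' a ≤ c * p a`. Removing the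
normalization this way costs the second factor `c`. -/
theorem IsStationary.le_of_row {Q Q' : Matrix A A ℝ} {p p' : A → ℝ} (h : IsStationary Q p)
    (h' : IsStationary Q' p') (hQ : IsPosStochastic Q) (hQ' : IsPosStochastic Q') {a : A} {c : ℝ}
    (hc : 1 ≤ c) (hrow : ∀ i, i ≠ a → Q' i = Q i) (ha : ∀ j, Q' a j ≤ c * Q a j)
    (ha' : ∀ j, Q a j ≤ c * Q' a j) (i : A) : p' i ≤ c ^ 2 * p i := by
  have h1 := h.mul_le_of_row h' hQ hrow ha i
  have h2 : p' a ≤ c * p a := by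
    have := sum_le_sum (s := univ) fun i _ =>
      h'.mul_le_of_row h hQ' (fun i hi => (hrow i hi).symm) ha' i
    rw [← sum_mul, ← mul_sum, ← sum_mul, h.1.2, h'.1.2] at this
    simpa using this
  have hpa := h.pos hQ a
  refine le_of_mul_le_mul_right (h1.trans ?_) hpa
  have := mul_le_mul_of_nonneg_left h2 (mul_nonneg (zero_le_one.trans hc) (h.1.1 i))
  linarith

/-- Hybrid argument: rows are exchanged one at a time, each exchange costing `exp (δ a) ^ 2`. The
intermediate chain `H` takes row `a` from `Q` and the others from `Q'`. -/
theorem IsStationary.le_of_rows [DecidableEq A] {Q : Matrix A A ℝ} {p : A → ℝ}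
    (h : IsStationary Q p) (hQ : IsPosStochastic Q) {δ : A → ℝ} (hδ : ∀ a, 0 ≤ δ a)
    (S : Finset A) :
    ∀ {Q' : Matrix A A ℝ} {p' : A → ℝ}, IsStationary Q' p' → IsPosStochastic Q' →
      (∀ i, i ∉ S → Q' i = Q i) → (∀ a j, Q' a j ≤ Real.exp (δ a) * Q a j) →
      (∀ a j, Q a j ≤ Real.exp (δ a) * Q' a j) →
      ∀ i, p' i ≤ Real.exp (2 * ∑ a ∈ S, δ a) * p i := by
  induction S using Finset.induction_on with
  | empty =>
    intro Q' p' h' hQ' hrow _ _ i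
    have := h.le_of_row h' hQ hQ' le_rfl (fun i _ => hrow i (notMem_empty i))
      (a := i) (fun j => by simp [hrow i (notMem_empty i)])
      (fun j => by simp [hrow i (notMem_empty i)]) i
    simpa using this
  | insert a S haS ih =>
    intro Q' p' h' hQ' hrow h1 h2 i
    have : Nonempty A := ⟨a⟩
    set H : Matrix A A ℝ := Function.update Q' a (Q a) with hH
    have Ha : H a = Q a := Function.update_self ..
    have Hne : ∀ i, i ≠ a → H i = Q' i := fun i hi => Function.update_of_ne hi ..
    have hHpos : IsPosStochastic H := fun i => by
      by_cases hi : i = a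
      · rw [hi, Ha]; exact hQ a
      · rw [Hne i hi]; exact hQ' i
    obtain ⟨q, hq⟩ := exists_isStationary fun a => (hHpos a).1
    have hself : ∀ j, Q a j ≤ Real.exp (δ a) * Q a j := fun j =>
      le_mul_of_one_le_left ((hQ a).2 j).le (Real.one_le_exp (hδ a))
    have hS := ih hq hHpos
      (fun i hi => by
        by_cases hia : i = a
        · rw [hia, Ha]
        · rw [Hne i hia, hrow i (by simp [hi, hia])])
      (fun i j => by
        by_cases hi : i = a
        · rw [hi, Ha]; exact hself j
        · rw [Hne i hi]; exact h1 i j)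
      (fun i j => by
        by_cases hi : i = a
        · rw [hi, Ha]; exact hself j
        · rw [Hne i hi]; exact h2 i j) i
    have hlast := hq.le_of_row h' hHpos hQ' (Real.one_le_exp (hδ a))
      (fun i hi => (Hne i hi).symm) (fun j => by rw [Ha]; exact h1 a j)
      (fun j => by rw [Ha]; exact h2 a j) i
    rw [sum_insert haS, mul_add, Real.exp_add, mul_assoc]
    refine hlast.trans ?_
    rw [← Real.exp_nat_mul, Nat.cast_ofNat]
    exact mul_le_mul_of_nonneg_left hS (Real.exp_pos _).le

/-- Stationary distributions are stable under multiplicative perturbations of the rows. -/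
theorem IsStationary.sum_abs_sub_le {Q Q' : Matrix A A ℝ} {p p' : A → ℝ} (h : IsStationary Q p)
    (h' : IsStationary Q' p') (hQ : IsPosStochastic Q) (hQ' : IsPosStochastic Q') {δ : A → ℝ}
    (hδ : ∀ a, 0 ≤ δ a) (h1 : ∀ a j, Q' a j ≤ Real.exp (δ a) * Q a j)
    (h2 : ∀ a j, Q a j ≤ Real.exp (δ a) * Q' a j) :
    ∑ i, |p' i - p i| ≤ Real.exp (2 * ∑ a, δ a) - 1 := by
  classical
  set E := Real.exp (2 * ∑ a, δ a) with hE
  have hE1 : 1 ≤ E := Real.one_le_exp (mul_nonneg two_pos.le (sum_nonneg fun a _ => hδ a))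
  have u1 := h.le_of_rows hQ hδ univ h' hQ' (by simp) h1 h2
  have u2 := h'.le_of_rows hQ' hδ univ h hQ (by simp) h2 h1
  calc ∑ i, |p' i - p i| ≤ ∑ i, (E - 1) * p i := by
        refine sum_le_sum fun i _ => abs_le.2 ⟨?_, by linarith [u1 i]⟩
        rcases le_total (p i) (p' i) with hle | hle
        · have := mul_nonneg (sub_nonneg.2 hE1) (h.1.1 i)
          linarith
        · have := mul_le_mul_of_nonneg_left hle (sub_nonneg.2 hE1)
          linarith [u2 i]
    _ = E - 1 := by rw [← mul_sum, h.1.2, mul_one]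

theorem sum_abs_sub_le_two {p q : A → ℝ} (hp : p ∈ stdSimplex ℝ A) (hq : q ∈ stdSimplex ℝ A) :
    ∑ i, |p i - q i| ≤ 2 := by
  calc ∑ i, |p i - q i| ≤ ∑ i, (p i + q i) := sum_le_sum fun i _ =>
        abs_le.2 ⟨by linarith [hp.1 i, hq.1 i], by linarith [hp.1 i, hq.1 i]⟩
    _ = 2 := by rw [sum_add_distrib, hp.2, hq.2]; norm_num

theorem IsStationary.sq_sum_abs_sub_le {Q Q' : Matrix A A ℝ} {p p' : A → ℝ}
    (h : IsStationary Q p) (h' : IsStationary Q' p') (hQ : IsPosStochastic Q)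
    (hQ' : IsPosStochastic Q') {δ : A → ℝ} (hδ : ∀ a, 0 ≤ δ a)
    (h1 : ∀ a j, Q' a j ≤ Real.exp (δ a) * Q a j)
    (h2 : ∀ a j, Q a j ≤ Real.exp (δ a) * Q' a j) :
    (∑ i, |p' i - p i|) ^ 2 ≤ 16 * Fintype.card A * ∑ a, δ a ^ 2 := by
  have hD : 0 ≤ ∑ a, δ a := sum_nonneg fun a _ => hδ a
  have hlin : ∑ i, |p' i - p i| ≤ 4 * ∑ a, δ a := by
    -- For `s ≤ 1`, `exp s - 1 ≤ 2 * s`; otherwise the trivial bound 2 on the `ℓ¹` distance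
    -- suffices.
    rcases le_total (2 * ∑ a, δ a) 1 with hs | hs
    · have := Real.abs_exp_sub_one_le (x := 2 * ∑ a, δ a) (by rwa [abs_of_nonneg (by positivity)])
      rw [abs_of_nonneg (a := 2 * _) (by positivity)] at this
      linarith [h.sum_abs_sub_le h' hQ hQ' hδ h1 h2, le_abs_self (Real.exp (2 * ∑ a, δ a) - 1)]
    · linarith [sum_abs_sub_le_two h'.1 h.1]
  have hcs : (∑ a, δ a) ^ 2 ≤ Fintype.card A * ∑ a, δ a ^ 2 := sq_sum_le_card_mul_sum_sq
  calc (∑ i, |p' i - p i|) ^ 2 ≤ (4 * ∑ a, δ a) ^ 2 :=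
        pow_le_pow_left₀ (sum_nonneg fun _ _ => abs_nonneg _) hlin 2
    _ ≤ 16 * Fintype.card A * ∑ a, δ a ^ 2 := by linarith

/-! ### The log-barrier and its Bregman divergence -/

/-- The Bregman divergence of the log-barrier on the simplex. -/
noncomputable def logBregman (p q : A → ℝ) : ℝ := ∑ r, (p r / q r - 1 - Real.log (p r / q r))

theorem sub_one_sub_log_nonneg {z : ℝ} (hz : 0 < z) : 0 ≤ z - 1 - Real.log z := by
  linarith [Real.log_le_sub_one_of_pos hz]

theorem logBregman_nonneg {p q : A → ℝ} (hp : ∀ r, 0 < p r) (hq : ∀ r, 0 < q r) :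
    0 ≤ logBregman p q :=
  sum_nonneg fun r _ => sub_one_sub_log_nonneg (div_pos (hp r) (hq r))

theorem logBregman_self {p : A → ℝ} (hp : ∀ r, 0 < p r) : logBregman p p = 0 :=
  sum_eq_zero fun r _ => by simp [div_self (hp r).ne']

/-- With `s = log z`, squaring `exp (s / 2) ≥ 1 + s / 2` gives `z ≥ 1 + s + s ^ 2 / 4`. The
smallness assumption ensures `s > -2`, so that squaring is monotone. -/
theorem sq_log_le {z : ℝ} (hz : 0 < z) (h : z - 1 - Real.log z < 1) :
    Real.log z ^ 2 ≤ 4 * (z - 1 - Real.log z) := by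
  have hs : -2 < Real.log z := by linarith
  have h1 := Real.add_one_le_exp (Real.log z / 2)
  have h2 : z = Real.exp (Real.log z / 2) ^ 2 := by
    rw [← Real.exp_nat_mul, Nat.cast_ofNat, mul_div_cancel₀ _ two_ne_zero, Real.exp_log hz]
  have h3 : (Real.log z / 2 + 1) ^ 2 ≤ z := by
    nth_rewrite 2 [h2]
    exact pow_le_pow_left₀ (by linarith) h1 2
  linarith

theorem sq_log_div_le {p q : A → ℝ} (hp : ∀ r, 0 < p r) (hq : ∀ r, 0 < q r)
    (h : logBregman p q < 1) (r : A) : Real.log (p r / q r) ^ 2 ≤ 4 * logBregman p q := by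
  have hr : p r / q r - 1 - Real.log (p r / q r) ≤ logBregman p q :=
    single_le_sum (f := fun r => p r / q r - 1 - Real.log (p r / q r))
      (fun r _ => sub_one_sub_log_nonneg (div_pos (hp r) (hq r))) (mem_univ r)
  linarith [sq_log_le (div_pos (hp r) (hq r)) (hr.trans_lt h)]

/-- A bound on the convex conjugate of `z ↦ 2 / 3 * (z - 1 - log z)`. -/
theorem mul_sub_one_sub_le {c z : ℝ} (hz : 0 < z) (hc : |c| ≤ 1 / 6) :
    c * (z - 1) - 2 / 3 * (z - 1 - Real.log z) ≤ 2 * c ^ 2 := by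
  obtain ⟨hc1, hc2⟩ := abs_le.1 hc
  -- The left side is largest at `z = 1 / (1 - b)`, where the tangent bound for `log ((1 - b) * z)`
  -- is sharp.
  set b := 3 / 2 * c with hb
  have hpos : 0 < 1 - b := by linarith
  have h1 := Real.log_le_sub_one_of_pos (mul_pos hpos hz)
  rw [Real.log_mul hpos.ne' hz.ne'] at h1
  have h2 := Real.one_sub_inv_le_log_of_pos hpos
  have h3 : (1 - b)⁻¹ ≤ 1 + b + 4 / 3 * b ^ 2 := by
    rw [inv_le_iff_one_le_mul₀ hpos]
    nlinarith [mul_nonneg (sq_nonneg b) (show 0 ≤ 1 - 4 * b by linarith)]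
  have h4 : c = 2 / 3 * b := by rw [hb]; ring
  rw [h4]
  linarith

/-- Two thirds of the divergence absorb the prediction error; the remaining third is kept to control
movement. The scalar bound is applied with `c = η * q r * v r`. -/
theorem sum_mul_sub_le {p q v : A → ℝ} (hp : ∀ r, 0 < p r) (hq : q ∈ relintSimplex A)
    {η : ℝ} (hη : 0 ≤ η) (hv : η * ‖v‖ ≤ 1 / 6) :
    η * ((p - q) ⬝ᵥ v) - 2 / 3 * logBregman p q ≤ 2 * η ^ 2 * ‖v‖ ^ 2 := by
  have hq1 : ∀ r, q r ≤ 1 := fun r => by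
    rw [← hq.1.2]
    exact single_le_sum (f := q) (fun i _ => hq.1.1 i) (mem_univ r)
  have hvr : ∀ r, |v r| ≤ ‖v‖ := fun r => norm_le_pi_norm v r
  calc η * ((p - q) ⬝ᵥ v) - 2 / 3 * logBregman p q
      = ∑ r, (η * q r * v r * (p r / q r - 1)
          - 2 / 3 * (p r / q r - 1 - Real.log (p r / q r))) := by
        rw [sum_sub_distrib, dotProduct, logBregman, mul_sum, mul_sum]
        congr 1
        refine sum_congr rfl fun r _ => ?_
        have := (hq.2 r).ne'
        rw [Pi.sub_apply]
        field_simp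
    _ ≤ ∑ r, 2 * (η ^ 2 * ‖v‖ ^ 2) * q r := by
        refine sum_le_sum fun r _ => (mul_sub_one_sub_le (div_pos (hp r) (hq.2 r)) ?_).trans ?_
        · rw [abs_mul, abs_mul, abs_of_nonneg hη, abs_of_pos (hq.2 r)]
          refine le_trans ?_ hv
          rw [mul_assoc]
          refine mul_le_mul_of_nonneg_left ?_ hη
          calc q r * |v r| ≤ 1 * ‖v‖ :=
                mul_le_mul (hq1 r) (hvr r) (abs_nonneg _) zero_le_one
            _ = ‖v‖ := one_mul _
        · have h1 : v r ^ 2 ≤ ‖v‖ ^ 2 := by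
            rw [← sq_abs]
            exact pow_le_pow_left₀ (abs_nonneg _) (hvr r) 2
          have h2 : q r ^ 2 ≤ q r := by
            rw [sq]
            exact mul_le_of_le_one_left (hq.2 r).le (hq1 r)
          calc 2 * (η * q r * v r) ^ 2 = 2 * η ^ 2 * (v r ^ 2 * q r ^ 2) := by ring
            _ ≤ 2 * η ^ 2 * (‖v‖ ^ 2 * q r) := by
                refine mul_le_mul_of_nonneg_left ?_ (by positivity)
                exact mul_le_mul h1 h2 (sq_nonneg _) (sq_nonneg _)
            _ = 2 * (η ^ 2 * ‖v‖ ^ 2) * q r := by ring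
    _ = 2 * η ^ 2 * ‖v‖ ^ 2 := by rw [← mul_sum, hq.1.2]; ring

theorem card_mul_log_le_logBarrier {p : A → ℝ} (hp : p ∈ relintSimplex A) :
    Fintype.card A * Real.log (Fintype.card A) ≤ logBarrier p := by
  have : Nonempty A := nonempty_of_mem_stdSimplex hp.1
  have hm : (0 : ℝ) < Fintype.card A := Nat.cast_pos.2 Fintype.card_pos
  have h : ∑ r, (Real.log (Fintype.card A) + Real.log (p r)) ≤
      ∑ r, (Fintype.card A * p r - 1) := sum_le_sum fun r _ => by
    rw [← Real.log_mul hm.ne' (hp.2 r).ne']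
    exact Real.log_le_sub_one_of_pos (mul_pos hm (hp.2 r))
  rw [sum_add_distrib, sum_sub_distrib, ← mul_sum, hp.1.2] at h
  simp only [sum_const, card_univ, nsmul_eq_mul, mul_one, sub_self] at h
  rw [logBarrier]
  linarith

theorem logBarrier_le {p : A → ℝ} {c : ℝ} (hc : 0 < c) (hp : ∀ r, c⁻¹ ≤ p r) :
    logBarrier p ≤ Fintype.card A * Real.log c := by
  have h : ∑ _r : A, -Real.log c ≤ ∑ r, Real.log (p r) := sum_le_sum fun r _ => by
    rw [← Real.log_inv]
    exact Real.log_le_log (inv_pos.2 hc) (hp r)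
  simp only [sum_const, card_univ, nsmul_eq_mul] at h
  rw [logBarrier]
  linarith

/-! ### Follow the regularized leader with the log-barrier -/

theorem uniform_mem_relintSimplex [Nonempty A] :
    (fun _ => (Fintype.card A : ℝ)⁻¹) ∈ relintSimplex A := by
  have hm : (0 : ℝ) < Fintype.card A := Nat.cast_pos.2 Fintype.card_pos
  refine ⟨⟨fun _ => by positivity, ?_⟩, fun _ => by positivity⟩
  simp [hm.ne']

theorem add_smul_mem_relintSimplex {p q : A → ℝ} (hp : p ∈ stdSimplex ℝ A)
    (hq : q ∈ relintSimplex A) {s t : ℝ} (hs : 0 ≤ s) (ht : 0 < t) (hst : s + t = 1) :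
    s • p + t • q ∈ relintSimplex A :=
  ⟨convex_stdSimplex ℝ A hp hq.1 hs ht.le hst, fun r =>
    add_pos_of_nonneg_of_pos (mul_nonneg hs (hp.1 r)) (mul_pos ht (hq.2 r))⟩

/-- The exponential of the objective extends continuously, by zero on the boundary, to the compact
simplex. Its maximum is positive, so it is attained in the interior. -/
theorem exists_isMaxOn_logBarrier [Nonempty A] (η : ℝ) (w : A → ℝ) :
    ∃ q ∈ relintSimplex A,
      IsMaxOn (fun y => η * (y ⬝ᵥ w) - logBarrier y) (relintSimplex A) q := by
  have hcont : Continuous fun y : A → ℝ => (∏ r, y r) * Real.exp (η * (y ⬝ᵥ w)) := by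
    unfold dotProduct
    fun_prop
  have hun := uniform_mem_relintSimplex (A := A)
  obtain ⟨q, hq, hmax⟩ := (isCompact_stdSimplex ℝ A).exists_isMaxOn ⟨_, hun.1⟩ hcont.continuousOn
  have hexp : ∀ y ∈ relintSimplex A, (∏ r, y r) * Real.exp (η * (y ⬝ᵥ w)) =
      Real.exp (η * (y ⬝ᵥ w) - logBarrier y) := fun y hy => by
    rw [logBarrier, sub_neg_eq_add, add_comm, Real.exp_add, Real.exp_sum]
    congr 1
    exact prod_congr rfl fun r _ => (Real.exp_log (hy.2 r)).symm
  have hpos : 0 < (∏ r, q r) * Real.exp (η * (q ⬝ᵥ w)) := by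
    refine lt_of_lt_of_le ?_ (hmax hun.1)
    exact mul_pos (prod_pos fun r _ => hun.2 r) (Real.exp_pos _)
  have hprod : 0 < ∏ r, q r := pos_of_mul_pos_left hpos (Real.exp_pos _).le
  have hqr : q ∈ relintSimplex A := ⟨hq, fun r =>
    lt_of_le_of_ne (hq.1 r) fun h => hprod.ne' (prod_eq_zero (mem_univ r) h.symm)⟩
  refine ⟨q, hqr, fun y hy => ?_⟩
  have h : (∏ r, y r) * Real.exp (η * (y ⬝ᵥ w)) ≤ (∏ r, q r) * Real.exp (η * (q ⬝ᵥ w)) :=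
    hmax hy.1
  rw [hexp y hy, hexp q hqr] at h
  exact Real.exp_le_exp.1 h

/-- The first-order optimality condition of the regularized leader. -/
theorem sum_div_sub_one_le_of_isMaxOn {η : ℝ} {w q y : A → ℝ} (hq : q ∈ relintSimplex A)
    (hmax : IsMaxOn (fun y => η * (y ⬝ᵥ w) - logBarrier y) (relintSimplex A) q)
    (hy : y ∈ relintSimplex A) :
    η * ((y - q) ⬝ᵥ w) + ∑ r, (y r / q r - 1) ≤ 0 := by
  set φ : ℝ → ℝ := fun s =>
    ∑ r, (η * ((q r + s * (y r - q r)) * w r) + Real.log (q r + s * (y r - q r))) with hφ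
  have hφeq : ∀ s, φ s = η * ((s • y + (1 - s) • q) ⬝ᵥ w) - logBarrier (s • y + (1 - s) • q) :=
    fun s => by
      have : ∀ r, (s • y + (1 - s) • q) r = q r + s * (y r - q r) := fun r => by
        simp only [Pi.add_apply, Pi.smul_apply, smul_eq_mul]; ring
      simp only [hφ, dotProduct, logBarrier, this, sum_add_distrib, mul_sum]
      ring
  have hderiv : HasDerivAt φ (η * ((y - q) ⬝ᵥ w) + ∑ r, (y r / q r - 1)) 0 := by
    rw [dotProduct, mul_sum, ← sum_add_distrib]
    refine HasDerivAt.fun_sum fun r _ => ?_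
    have hlin : HasDerivAt (fun s : ℝ => q r + s * (y r - q r)) (y r - q r) 0 := by
      simpa using ((hasDerivAt_id (0 : ℝ)).mul_const (y r - q r)).const_add (q r)
    have hne := (hq.2 r).ne'
    refine (((hlin.mul_const (w r)).const_mul η).add (hlin.log (by simpa using hne))).congr_deriv ?_
    rw [Pi.sub_apply, zero_mul, add_zero, sub_div, div_self hne]
  have hloc : IsLocalMaxOn φ (Set.Icc 0 1) 0 := by
    refine IsMaxOn.localize fun s hs => ?_
    have h0 : φ 0 = η * (q ⬝ᵥ w) - logBarrier q := by rw [hφeq]; simp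
    show φ s ≤ φ 0
    rw [h0, hφeq]
    rcases hs.2.lt_or_eq with h1 | h1
    · exact hmax (add_smul_mem_relintSimplex hy.1 hq hs.1 (sub_pos.2 h1) (by ring))
    · have := hmax hy
      simpa [h1] using this
  have := hloc.hasFDerivWithinAt_nonpos hderiv.hasFDerivAt.hasFDerivWithinAt
    (y := (1 : ℝ)) (mem_posTangentConeAt_of_segment_subset (by
      rw [zero_add, segment_eq_Icc zero_le_one]))
  simpa using this

theorem logBregman_le_of_isMaxOn {η : ℝ} {w q y : A → ℝ} (hq : q ∈ relintSimplex A)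
    (hmax : IsMaxOn (fun y => η * (y ⬝ᵥ w) - logBarrier y) (relintSimplex A) q)
    (hy : y ∈ relintSimplex A) :
    η * (y ⬝ᵥ w) - logBarrier y + logBregman y q ≤ η * (q ⬝ᵥ w) - logBarrier q := by
  have h := sum_div_sub_one_le_of_isMaxOn hq hmax hy
  have hlog : ∑ r, Real.log (y r / q r) = ∑ r, Real.log (y r) - ∑ r, Real.log (q r) := by
    rw [← sum_sub_distrib]
    exact sum_congr rfl fun r _ => Real.log_div (hy.2 r).ne' (hq.2 r).ne'
  rw [sub_dotProduct, mul_sub] at h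
  rw [logBregman, sum_sub_distrib, hlog, logBarrier, logBarrier]
  linarith

/-- The regret of optimistic follow the regularized leader, in terms of the leaders `y`. -/
theorem IsOFTRL.exists_leader {η : ℝ} {u x : ℕ → A → ℝ}
    (h : IsOFTRL (relintSimplex A) logBarrier η u x) :
    ∃ y : ℕ → A → ℝ, (∀ t, y t ∈ relintSimplex A) ∧ y 0 = x 0 ∧
      ∀ T, ∀ z ∈ relintSimplex A,
        η * ∑ t ∈ Icc 1 T, (z - x t) ⬝ᵥ u t ≤ logBarrier z - logBarrier (x 0) +
          ∑ t ∈ Icc 1 T, (η * ((y t - x t) ⬝ᵥ (u t - u (t - 1)))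
            - logBregman (y t) (x t) - logBregman (x t) (y (t - 1))) := by
  have : Nonempty A := nonempty_of_mem_stdSimplex h.1.1.1
  -- `y t` is the leader that has already seen `u t`. Choosing `y 0 = x 0` makes the divergence at
  -- time 0 vanish.
  have hex : ∀ t, ∃ q : A → ℝ, (q ∈ relintSimplex A ∧
      IsMaxOn (fun z => η * (z ⬝ᵥ ∑ τ ∈ Icc 1 t, u τ) - logBarrier z) (relintSimplex A) q) ∧
      (t = 0 → q = x 0) := fun t => by
    rcases eq_or_ne t 0 with rfl | ht
    · refine ⟨x 0, ⟨h.1.1, ?_⟩, fun _ => rfl⟩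
      simpa using h.1.2.neg
    · obtain ⟨q, hq, hmax⟩ := exists_isMaxOn_logBarrier η (∑ τ ∈ Icc 1 t, u τ)
      exact ⟨q, ⟨hq, hmax⟩, fun h0 => absurd h0 ht⟩
  choose y hy using hex
  have hy0 : y 0 = x 0 := (hy 0).2 rfl
  refine ⟨y, fun t => (hy t).1.1, hy0, fun T z hz => ?_⟩
  -- Be-the-leader induction through `y T`, `x (T + 1)`, `y (T + 1)`: each comparison gains a
  -- divergence, and the last two objectives differ by the prediction error `u (T + 1) - u T`.
  have key : ∀ T, η * (y T ⬝ᵥ ∑ τ ∈ Icc 1 T, u τ) - logBarrier (y T) ≤ -logBarrier (x 0) +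
      ∑ t ∈ Icc 1 T, (η * (x t ⬝ᵥ u t) + (η * ((y t - x t) ⬝ᵥ (u t - u (t - 1)))
            - logBregman (y t) (x t) - logBregman (x t) (y (t - 1)))) := fun T => by
    induction T with
    | zero => simp [hy0]
    | succ T ih =>
      have hx := h.2 (T + 1) (Nat.le_add_left 1 T)
      rw [Nat.add_sub_cancel] at hx
      have e1 := logBregman_le_of_isMaxOn hx.1 hx.2 (hy (T + 1)).1.1
      have e2 := logBregman_le_of_isMaxOn (hy T).1.1 (hy T).1.2 hx.1
      rw [sum_Icc_succ_top (Nat.le_add_left 1 T), sum_Icc_succ_top (Nat.le_add_left 1 T),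
        Nat.add_sub_cancel]
      simp only [dotProduct_add, dotProduct_sub, sub_dotProduct, mul_add, mul_sub] at *
      linarith
  have hz : η * (z ⬝ᵥ ∑ τ ∈ Icc 1 T, u τ) - logBarrier z ≤
      η * (y T ⬝ᵥ ∑ τ ∈ Icc 1 T, u τ) - logBarrier (y T) := (hy T).1.2 hz
  have hsum : ∑ t ∈ Icc 1 T, (z - x t) ⬝ᵥ u t =
      z ⬝ᵥ ∑ τ ∈ Icc 1 T, u τ - ∑ t ∈ Icc 1 T, x t ⬝ᵥ u t := by
    rw [dotProduct_sum, ← sum_sub_distrib]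
    exact sum_congr rfl fun t _ => sub_dotProduct ..
  have hk := key T
  rw [sum_add_distrib, ← mul_sum] at hk
  rw [hsum, mul_sub]
  linarith

/-- The RVU bound of optimistic follow the regularized leader with the log-barrier. -/
theorem IsOFTRL.exists_rvu {η : ℝ} (hη : 0 ≤ η) {u x : ℕ → A → ℝ} {T : ℕ}
    (h : IsOFTRL (relintSimplex A) logBarrier η u x)
    (hu : ∀ t ∈ Icc 1 T, η * ‖u t - u (t - 1)‖ ≤ 1 / 6) :
    ∃ y : ℕ → A → ℝ, (∀ t, y t ∈ relintSimplex A) ∧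
      ∀ z ∈ relintSimplex A,
        η * ∑ t ∈ Icc 1 T, (z - x t) ⬝ᵥ u t ≤ logBarrier z - logBarrier (x 0) +
          2 * η ^ 2 * ∑ t ∈ Icc 1 T, ‖u t - u (t - 1)‖ ^ 2
          - ∑ t ∈ Icc 1 T, (logBregman (x t) (y (t - 1))
              + 1 / 3 * logBregman (y (t - 1)) (x (t - 1))) := by
  obtain ⟨y, hy, hy0, hreg⟩ := h.exists_leader
  refine ⟨y, hy, fun z hz => (hreg T z hz).trans ?_⟩
  have hstep : ∑ t ∈ Icc 1 T, (η * ((y t - x t) ⬝ᵥ (u t - u (t - 1)))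
      - 2 / 3 * logBregman (y t) (x t)) ≤
      2 * η ^ 2 * ∑ t ∈ Icc 1 T, ‖u t - u (t - 1)‖ ^ 2 := by
    rw [mul_sum]
    exact sum_le_sum fun t ht =>
      sum_mul_sub_le (hy t).2 (h.2 t (mem_Icc.1 ht).1).1 hη (hu t ht)
  -- Shifts the remaining third of `logBregman (y t) (x t)` back by one step, so that it links `x (t
  -- - 1)` to `x t` through `y (t - 1)`.
  have hshift : ∀ T, ∑ t ∈ Icc 1 T, logBregman (y (t - 1)) (x (t - 1)) + logBregman (y T) (x T) =
      ∑ t ∈ Icc 1 T, logBregman (y t) (x t) := fun T => by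
    induction T with
    | zero => simp [hy0, logBregman_self h.1.1.2]
    | succ T ih =>
      rw [sum_Icc_succ_top (Nat.le_add_left 1 T), sum_Icc_succ_top (Nat.le_add_left 1 T),
        Nat.add_sub_cancel, ih]
  have hx : ∀ t, x t ∈ relintSimplex A := fun t => by
    rcases Nat.eq_zero_or_pos t with rfl | ht
    · exact h.1.1
    · exact (h.2 t ht).1
  have hlast := logBregman_nonneg (hy T).2 (hx T).2
  have hT := hshift T
  simp only [sum_sub_distrib, sum_add_distrib, ← mul_sum] at hstep ⊢
  linarith

/-! ### Swap regret of the Blum–Mansour algorithm -/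

/-- If some divergence is at least 1, the diameter 2 of the simplex suffices. Otherwise the
log-ratios through `Y` add, with square at most `24 * d a`, and `384 = 16 * 24`. -/
theorem IsStationary.sq_sum_abs_sub_le_logBregman {Q Q' Y : Matrix A A ℝ} {p p' : A → ℝ}
    (h : IsStationary Q p) (h' : IsStationary Q' p') (hQ : IsPosStochastic Q)
    (hQ' : IsPosStochastic Q') (hY : IsPosStochastic Y) :
    (∑ i, |p' i - p i|) ^ 2 ≤ 384 * Fintype.card A *
      ∑ a, (logBregman (Q' a) (Y a) + 1 / 3 * logBregman (Y a) (Q a)) := by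
  have : Nonempty A := nonempty_of_mem_stdSimplex h.1
  have hm : (1 : ℝ) ≤ Fintype.card A := Nat.one_le_cast.2 Fintype.card_pos
  have hA := fun a => logBregman_nonneg (hQ' a).2 (hY a).2
  have hB := fun a => logBregman_nonneg (hY a).2 (hQ a).2
  set d : A → ℝ := fun a => logBregman (Q' a) (Y a) + 1 / 3 * logBregman (Y a) (Q a) with hd
  have hd0 : ∀ a, 0 ≤ d a := fun a => by simp only [hd]; linarith [hA a, hB a]
  by_cases hbig : ∃ a, 1 ≤ logBregman (Q' a) (Y a) ∨ 1 ≤ logBregman (Y a) (Q a)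
  · obtain ⟨a, ha⟩ := hbig
    have h1 : 1 / 3 ≤ d a := by
      simp only [hd]
      rcases ha with ha | ha <;> linarith [hA a, hB a]
    have h2 : 1 / 3 ≤ ∑ a, d a :=
      h1.trans (single_le_sum (f := d) (fun a _ => hd0 a) (mem_univ a))
    calc (∑ i, |p' i - p i|) ^ 2 ≤ 2 ^ 2 :=
          pow_le_pow_left₀ (sum_nonneg fun _ _ => abs_nonneg _) (sum_abs_sub_le_two h'.1 h.1) 2
      _ ≤ 384 * 1 * (1 / 3) := by norm_num
      _ ≤ 384 * Fintype.card A * ∑ a, d a := by gcongr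
  · push Not at hbig
    have hlog : ∀ a j, |Real.log (Q' a j / Q a j)| ≤ √(24 * d a) := fun a j => by
      refine Real.abs_le_sqrt ?_
      have h1 := sq_log_div_le (hQ' a).2 (hY a).2 (hbig a).1 j
      have h2 := sq_log_div_le (hY a).2 (hQ a).2 (hbig a).2 j
      have e : Real.log (Q' a j / Q a j) =
          Real.log (Q' a j / Y a j) + Real.log (Y a j / Q a j) := by
        rw [← Real.log_mul (div_pos ((hQ' a).2 j) ((hY a).2 j)).ne'
          (div_pos ((hY a).2 j) ((hQ a).2 j)).ne', div_mul_div_cancel₀ ((hY a).2 j).ne']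
      rw [e]
      refine add_sq_le.trans ?_
      simp only [hd]
      linarith [hA a]
    have h1 : ∀ a j, Q' a j ≤ Real.exp (√(24 * d a)) * Q a j := fun a j => by
      rw [← div_le_iff₀ ((hQ a).2 j), ← Real.log_le_iff_le_exp (div_pos ((hQ' a).2 j) ((hQ a).2 j))]
      exact (le_abs_self _).trans (hlog a j)
    have h2 : ∀ a j, Q a j ≤ Real.exp (√(24 * d a)) * Q' a j := fun a j => by
      rw [← div_le_iff₀ ((hQ' a).2 j), ← Real.log_le_iff_le_exp (div_pos ((hQ a).2 j) ((hQ' a).2 j)),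
        ← inv_div, Real.log_inv]
      exact (neg_le_abs _).trans (hlog a j)
    refine (h.sq_sum_abs_sub_le h' hQ hQ' (fun a => Real.sqrt_nonneg _) h1 h2).trans (le_of_eq ?_)
    have : ∑ a, √(24 * d a) ^ 2 = 24 * ∑ a, d a := by
      rw [mul_sum]
      exact sum_congr rfl fun a _ => Real.sq_sqrt (mul_nonneg (by norm_num) (hd0 a))
    rw [this]
    ring

theorem abs_dotProduct_le_norm {p : A → ℝ} (hp : p ∈ stdSimplex ℝ A) (v : A → ℝ) :
    |p ⬝ᵥ v| ≤ ‖v‖ := by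
  calc |p ⬝ᵥ v| ≤ ∑ r, p r * ‖v‖ := by
        refine (abs_sum_le_sum_abs _ _).trans (sum_le_sum fun r _ => ?_)
        rw [abs_mul, abs_of_nonneg (hp.1 r)]
        exact mul_le_mul_of_nonneg_left (norm_le_pi_norm v r) (hp.1 r)
    _ = ‖v‖ := by rw [← sum_mul, hp.2, one_mul]

theorem norm_smul_sub_smul_le {s s' : ℝ} {v v' : A → ℝ} (hs : 0 ≤ s) (hv' : ‖v'‖ ≤ 1) :
    ‖s • v - s' • v'‖ ≤ s * ‖v - v'‖ + |s - s'| := by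
  have e : s • v - s' • v' = s • (v - v') + (s - s') • v' := by
    rw [smul_sub, sub_smul]; abel
  rw [e]
  refine (norm_add_le _ _).trans ?_
  rw [norm_smul, norm_smul, Real.norm_of_nonneg hs, Real.norm_eq_abs]
  gcongr
  exact mul_le_of_le_one_right (abs_nonneg _) hv'

theorem sum_norm_smul_sub_smul_sq_le {p p' v v' : A → ℝ} (hp : p ∈ stdSimplex ℝ A)
    (hv' : ‖v'‖ ≤ 1) :
    ∑ a, ‖p a • v - p' a • v'‖ ^ 2 ≤ 2 * ‖v - v'‖ ^ 2 + 2 * (∑ a, |p a - p' a|) ^ 2 := by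
  have h1 : ∑ a, p a ^ 2 ≤ 1 := by
    have := sum_sq_le_sq_sum_of_nonneg (s := univ) (f := p) fun a _ => hp.1 a
    rwa [hp.2, one_pow] at this
  have h2 : ∑ a, |p a - p' a| ^ 2 ≤ (∑ a, |p a - p' a|) ^ 2 :=
    sum_sq_le_sq_sum_of_nonneg fun a _ => abs_nonneg _
  calc ∑ a, ‖p a • v - p' a • v'‖ ^ 2
      ≤ ∑ a, (2 * ‖v - v'‖ ^ 2 * p a ^ 2 + 2 * |p a - p' a| ^ 2) := by
        refine sum_le_sum fun a _ => ?_
        refine (pow_le_pow_left₀ (norm_nonneg _) (norm_smul_sub_smul_le (hp.1 a) hv') 2).trans ?_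
        refine add_sq_le.trans (le_of_eq ?_)
        ring
    _ = 2 * ‖v - v'‖ ^ 2 * ∑ a, p a ^ 2 + 2 * ∑ a, |p a - p' a| ^ 2 := by
        rw [sum_add_distrib, mul_sum, mul_sum]
    _ ≤ 2 * ‖v - v'‖ ^ 2 + 2 * (∑ a, |p a - p' a|) ^ 2 := by
        exact add_le_add (mul_le_of_le_one_right (by positivity) h1)
          (mul_le_mul_of_nonneg_left h2 two_pos.le)

theorem IsRun.isPosStochastic {η : ℝ} {u x : ℕ → A → ℝ} {Q : ℕ → Matrix A A ℝ}
    (h : IsRun η u Q x) (t : ℕ) : IsPosStochastic (Q t) := fun a => by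
  rcases Nat.eq_zero_or_pos t with rfl | ht
  · exact (h.1 a).1.1
  · exact ((h.1 a).2 t ht).1

/-- The bound on the weighted sum of the internal regrets against interior comparators. -/
theorem IsRun.sum_regret_le {η : ℝ} {u x : ℕ → A → ℝ} {Q : ℕ → Matrix A A ℝ}
    (h : IsRun η u Q x) (hη : 0 < η) (hη' : η ≤ 1 / (128 * √(Fintype.card A))) {T : ℕ}
    (hu : ∀ t, t ≤ T → ‖u t‖ ≤ 1) {Z : Matrix A A ℝ} (hZ : IsPosStochastic Z) :
    η * ∑ a, ∑ t ∈ Icc 1 T, (Z a - Q t a) ⬝ᵥ (x t a • u t) ≤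
      ∑ a, (logBarrier (Z a) - logBarrier (Q 0 a))
        + 4 * η ^ 2 * ∑ t ∈ Icc 1 T, ‖u t - u (t - 1)‖ ^ 2
        - 1 / (2048 * Fintype.card A) *
          ∑ t ∈ Icc 1 T, (∑ a, |x t a - x (t - 1) a|) ^ 2 := by
  have : Nonempty A := nonempty_of_mem_stdSimplex (h.2 0).1
  have hm : (1 : ℝ) ≤ Fintype.card A := Nat.one_le_cast.2 Fintype.card_pos
  set m : ℝ := (Fintype.card A : ℝ) with hmdef
  have hm0 : 0 < m := by linarith
  have hsqrt : 1 ≤ √m := Real.one_le_sqrt.2 hm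
  have hη128 : η ≤ 1 / 128 := hη'.trans (by
    apply one_div_le_one_div_of_le <;> linarith)
  have hηsq : η ^ 2 ≤ 1 / (16384 * m) := by
    refine (pow_le_pow_left₀ hη.le hη' 2).trans (le_of_eq ?_)
    rw [div_pow, mul_pow, Real.sq_sqrt hm0.le]
    norm_num
  have hx := fun t => (h.2 t).1
  have hsmall : ∀ a, ∀ t ∈ Icc 1 T,
      η * ‖x t a • u t - x (t - 1) a • u (t - 1)‖ ≤ 1 / 6 := fun a t ht => by
    obtain ⟨ht1, htT⟩ := mem_Icc.1 ht
    have hle1 : ∀ t, x t a ≤ 1 := fun t => by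
      rw [← (hx t).2]
      exact single_le_sum (f := x t) (fun i _ => (hx t).1 i) (mem_univ a)
    have hb : ∀ s, s ≤ T → ‖x s a • u s‖ ≤ 1 := fun s hs => by
      rw [norm_smul, Real.norm_of_nonneg ((hx s).1 a)]
      exact mul_le_one₀ (hle1 s) (norm_nonneg _) (hu s hs)
    have h2 : ‖x t a • u t - x (t - 1) a • u (t - 1)‖ ≤ 2 :=
      (norm_sub_le _ _).trans (by linarith [hb t htT, hb (t - 1) (by omega)])
    calc η * ‖x t a • u t - x (t - 1) a • u (t - 1)‖ ≤ 1 / 128 * 2 := by gcongr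
      _ ≤ 1 / 6 := by norm_num
  choose Y hY hreg using fun a => (h.1 a).exists_rvu hη.le (hsmall a)
  have hsum := sum_le_sum (s := univ) fun a _ => hreg a (Z a) (hZ a)
  rw [← mul_sum, sum_sub_distrib, sum_add_distrib, ← mul_sum, sum_comm (s := univ) (t := Icc 1 T)
    (f := fun a t => ‖x t a • u t - x (t - 1) a • u (t - 1)‖ ^ 2), sum_comm (s := univ)
    (t := Icc 1 T) (f := fun a t => logBregman (Q t a) (Y a (t - 1)) +
      1 / 3 * logBregman (Y a (t - 1)) (Q (t - 1) a))] at hsum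
  refine hsum.trans ?_
  rw [add_sub_assoc, add_sub_assoc]
  refine add_le_add_right ?_ _
  simp only [mul_sum, ← sum_sub_distrib]
  refine sum_le_sum fun t ht => ?_
  obtain ⟨ht1, htT⟩ := mem_Icc.1 ht
  set X := (∑ a, |x t a - x (t - 1) a|) ^ 2 with hX
  have hX0 : 0 ≤ X := sq_nonneg _
  have hs1 := sum_norm_smul_sub_smul_sq_le (p' := x (t - 1)) (v := u t) (hx t)
    (hu (t - 1) (by omega))
  have hs2 := IsStationary.sq_sum_abs_sub_le_logBregman (Y := fun a => Y a (t - 1))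
    (h.2 (t - 1)) (h.2 t) (h.isPosStochastic _) (h.isPosStochastic _) fun a => hY a _
  rw [← hX] at hs1 hs2
  set S := ∑ a, ‖x t a • u t - x (t - 1) a • u (t - 1)‖ ^ 2 with hS
  have h3 : 2 * η ^ 2 * S ≤ 4 * η ^ 2 * ‖u t - u (t - 1)‖ ^ 2 + 4 * η ^ 2 * X := by
    have := mul_le_mul_of_nonneg_left hs1 (show 0 ≤ 2 * η ^ 2 by positivity)
    linarith
  have h4 : 4 * η ^ 2 * X ≤ 1 / 4096 * (X / m) := by
    calc 4 * η ^ 2 * X ≤ 4 * (1 / (16384 * m)) * X := by gcongr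
      _ = 1 / 4096 * (X / m) := by field_simp; ring
  -- The divergences supply `1 / 384`, of which `h4` consumes `1 / 4096`; more than `1 / 2048`
  -- remains.
  have h5 : 1 / 384 * (X / m) ≤ ∑ a, (logBregman (Q t a) (Y a (t - 1)) +
      1 / 3 * logBregman (Y a (t - 1)) (Q (t - 1) a)) := by
    rw [one_div_mul_eq_div, div_div, div_le_iff₀ (by positivity)]
    linarith
  have h6 : 1 / (2048 * m) * X = 1 / 2048 * (X / m) := by field_simp
  have h7 : 0 ≤ X / m := by positivity
  rw [sum_sub_distrib, ← mul_sum, ← hS, h6]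
  linarith

theorem dotProduct_eq_sum_single [DecidableEq A] (φ : (A → ℝ) →ₗ[ℝ] (A → ℝ)) (p v : A → ℝ) :
    φ p ⬝ᵥ v = ∑ a, φ (Pi.single a 1) ⬝ᵥ (p a • v) := by
  rw [LinearMap.pi_apply_eq_sum_univ φ p, sum_dotProduct]
  refine sum_congr rfl fun a _ => ?_
  rw [smul_dotProduct, dotProduct_smul]
  congr 3
  ext j
  simp [Pi.single_apply, eq_comm]

theorem IsStationary.dotProduct_eq {Q : Matrix A A ℝ} {p : A → ℝ} (h : IsStationary Q p)
    (v : A → ℝ) : p ⬝ᵥ v = ∑ a, Q a ⬝ᵥ (p a • v) := by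
  simp only [dotProduct, Pi.smul_apply, smul_eq_mul]
  rw [sum_comm]
  refine sum_congr rfl fun j _ => ?_
  rw [← h.sum_eq j, sum_mul]
  exact sum_congr rfl fun a _ => by ring

/-- The swap regret is the sum of the internal regrets. -/
theorem IsRun.swapGain_eq [DecidableEq A] {η : ℝ} {u x : ℕ → A → ℝ} {Q : ℕ → Matrix A A ℝ}
    (h : IsRun η u Q x) (φ : (A → ℝ) →ₗ[ℝ] (A → ℝ)) (T : ℕ) :
    ∑ t ∈ Icc 1 T, φ (x t) ⬝ᵥ u t - ∑ t ∈ Icc 1 T, x t ⬝ᵥ u t =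
      ∑ a, ∑ t ∈ Icc 1 T, (φ (Pi.single a 1) - Q t a) ⬝ᵥ (x t a • u t) := by
  rw [← sum_sub_distrib, sum_comm]
  refine sum_congr rfl fun t _ => ?_
  rw [dotProduct_eq_sum_single φ, IsStationary.dotProduct_eq (h.2 t), ← sum_sub_distrib]
  exact sum_congr rfl fun a _ => (sub_dotProduct ..).symm

/-- The cost of moving a comparator into the interior of the simplex. -/
theorem IsRun.sum_dotProduct_mix_le {η : ℝ} {u x : ℕ → A → ℝ} {Q : ℕ → Matrix A A ℝ}
    (h : IsRun η u Q x) {T : ℕ} (hT : 0 < T) (hu : ∀ t, t ≤ T → ‖u t‖ ≤ 1)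
    {P : Matrix A A ℝ} (hP : ∀ a, P a ∈ stdSimplex ℝ A) {w : A → ℝ} (hw : w ∈ stdSimplex ℝ A) :
    ∑ a, ∑ t ∈ Icc 1 T, (P a - Q t a) ⬝ᵥ (x t a • u t) ≤
      ∑ a, ∑ t ∈ Icc 1 T,
        ((1 - (T : ℝ)⁻¹) • P a + (T : ℝ)⁻¹ • w - Q t a) ⬝ᵥ (x t a • u t) + 2 := by
  have hT0 : (0 : ℝ) < T := Nat.cast_pos.2 hT
  have hterm : ∀ a, ∀ t ∈ Icc 1 T, (P a - Q t a) ⬝ᵥ (x t a • u t) ≤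
      ((1 - (T : ℝ)⁻¹) • P a + (T : ℝ)⁻¹ • w - Q t a) ⬝ᵥ (x t a • u t)
        + 2 * (T : ℝ)⁻¹ * x t a := fun a t ht => by
    have hut := hu t (mem_Icc.1 ht).2
    have h1 := (le_abs_self _).trans ((abs_dotProduct_le_norm (hP a) (u t)).trans hut)
    have h2 := (neg_le_abs _).trans ((abs_dotProduct_le_norm hw (u t)).trans hut)
    have h3 : P a ⬝ᵥ u t - w ⬝ᵥ u t ≤ 2 := by linarith
    have h4 := mul_le_mul_of_nonneg_left h3
      (mul_nonneg (inv_nonneg.2 hT0.le) ((h.2 t).1.1 a))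
    simp only [sub_dotProduct, add_dotProduct, smul_dotProduct, dotProduct_smul, smul_eq_mul]
    linarith
  -- The weights `x t a` sum to 1 over `a`, so each of the `T` rounds costs `2 / T`.
  have hcost : ∑ a, ∑ t ∈ Icc 1 T, 2 * (T : ℝ)⁻¹ * x t a = 2 := by
    rw [sum_comm]
    simp only [← mul_sum, (h.2 _).1.2]
    simp [hT0.ne']
  rw [← hcost, ← sum_add_distrib]
  refine sum_le_sum fun a _ => ?_
  rw [← sum_add_distrib]
  exact sum_le_sum (hterm a)

end BMOFTRL

open Finset Matrix BMOFTRL in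
theorem mainTheorem4 {A : Type*} [Fintype A] (η : ℝ) (hη : 0 < η)
    (hη' : η ≤ 1 / (128 * Real.sqrt (Fintype.card A)))
    (u : ℕ → A → ℝ) (Q : ℕ → Matrix A A ℝ) (x : ℕ → A → ℝ)
    (hrun : BMOFTRL.IsRun η u Q x)
    (T : ℕ) (hT : 2 ≤ T) (hu : ∀ t, t ≤ T → ‖u t‖ ≤ 1) :
    BMOFTRL.swapRegret u x T ≤
      2 * (Fintype.card A : ℝ) ^ 2 * Real.log T / η
        + 4 * η * ∑ t ∈ Finset.Icc 1 T, ‖u t - u (t - 1)‖ ^ 2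
        - 1 / (2048 * (Fintype.card A : ℝ) * η)
          * ∑ t ∈ Finset.Icc 1 T, (∑ a, |x t a - x (t - 1) a|) ^ 2 := by
  classical
  refine (isLUB_swapRegret u x T fun t => (hrun.2 t).1).2 ?_
  rintro _ ⟨φ, hφ, rfl⟩
  have : Nonempty A := nonempty_of_mem_stdSimplex (hrun.2 0).1
  have hm : (1 : ℝ) ≤ Fintype.card A := Nat.one_le_cast.2 Fintype.card_pos
  have hm0 : (0 : ℝ) < Fintype.card A := by linarith
  have hT2 : (2 : ℝ) ≤ T := by exact_mod_cast hT
  have hT0 : (0 : ℝ) < T := by linarith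
  have hTinv : (T : ℝ)⁻¹ ≤ 1 := inv_le_one_of_one_le₀ (by linarith)
  have hP : ∀ a, φ (Pi.single a 1) ∈ stdSimplex ℝ A := fun a => hφ (single_mem_stdSimplex ℝ a)
  set w : A → ℝ := fun _ => (Fintype.card A : ℝ)⁻¹ with hw
  have hwmem : w ∈ relintSimplex A := uniform_mem_relintSimplex
  set Z : Matrix A A ℝ := fun a => (1 - (T : ℝ)⁻¹) • φ (Pi.single a 1) + (T : ℝ)⁻¹ • w with hZdef
  have hZ : IsPosStochastic Z := fun a =>
    add_smul_mem_relintSimplex (hP a) hwmem (sub_nonneg.2 hTinv) (inv_pos.2 hT0) (by ring)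
  have hreg := hrun.sum_regret_le hη hη' hu hZ
  have hmix := hrun.sum_dotProduct_mix_le (by omega) hu hP hwmem.1
  rw [hrun.swapGain_eq φ T]
  -- Coordinates of `Z a` are at least `1 / (T * m)`, where `m` is the number of actions, and the
  -- barrier is at least `m * log m` everywhere; the terms in `log m` cancel.
  have hbar : ∑ a, (logBarrier (Z a) - logBarrier (Q 0 a)) ≤
      (Fintype.card A : ℝ) ^ 2 * Real.log T := by
    have hrow : ∀ a, logBarrier (Z a) - logBarrier (Q 0 a) ≤ Fintype.card A * Real.log T :=
      fun a => by
        have h1 := logBarrier_le (p := Z a) (mul_pos hT0 hm0) fun r => by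
          rw [mul_inv]
          exact le_add_of_nonneg_left (mul_nonneg (sub_nonneg.2 hTinv) ((hP a).1 r))
        have h2 := card_mul_log_le_logBarrier (hrun.isPosStochastic 0 a)
        rw [Real.log_mul hT0.ne' hm0.ne'] at h1
        linarith
    refine (sum_le_sum fun a _ => hrow a).trans (le_of_eq ?_)
    rw [sum_const, card_univ, nsmul_eq_mul]
    ring
  -- The mixing cost is absorbed by a second copy of the barrier term, hence the factor 2 in the
  -- bound. This is where `T ≥ 2` keeps `log T` away from 0.
  have hconst : 2 * η ≤ (Fintype.card A : ℝ) ^ 2 * Real.log T := by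
    have hlog : 1 / 2 ≤ Real.log T := by
      have := Real.log_le_log two_pos hT2
      linarith [Real.log_two_gt_d9]
    have hη128 : η ≤ 1 / 128 := hη'.trans (by
      have := Real.one_le_sqrt.2 hm
      apply one_div_le_one_div_of_le <;> linarith)
    calc 2 * η ≤ 1 * (1 / 2) := by linarith
      _ ≤ (Fintype.card A : ℝ) ^ 2 * Real.log T :=
        mul_le_mul (one_le_pow₀ hm) hlog (by norm_num) (by positivity)
  refine hmix.trans ?_
  refine le_of_mul_le_mul_left ?_ hη
  have e : ∀ a b c d : ℝ, 0 < d → η * (a / η + 4 * η * b - 1 / (2048 * d * η) * c) =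
      a + 4 * η ^ 2 * b - 1 / (2048 * d) * c := fun a b c d hd => by field_simp
  rw [e _ _ _ _ hm0, mul_add]
  simp only [hZdef] at hreg hbar
  linarith
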